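/- Let $\mathcal H$ be a complex inner product space (for example a Hilbert space; the inner product is linear in the second argument), let $E\subseteq\mathcal H$ be a real linear subspace (for example $E=\mathcal H$), with $\sigma(f,g)=\operatorname{Im}\langle f,g\rangle$ and $\|f\|=\langle f,f\rangle^{1/2}$ for $f,g\in E$, and let $h\ge 0$. For $k\ge 0$ let $\Delta(E,k\sigma)$ be the unital $*$-algebra of finite complex linear combinations of linearly independent Weyl elements $W^k(f)$, $f\in E$, with $W^k(f)W^k(g)=e^{-\frac i2 k\sigma(f,g)}W^k(f+g)$, $W^k(f)^*=W^k(-f)$ and $W^k(0)=I$. Let $\|A\|_k=\sup_\omega \omega(A^*A)^{1/2}$, where $\omega$ runs over all states of $\Delta(E,k\sigma)$, i.e. the linear functionals with $\omega(B^*B)\ge 0$ for all $B$ and $\omega(I)=1$; this is a $C^*$-norm, and $\mathcal W(E,k\sigma)$ denotes the $C^*$-algebra obtained by completion. Let $Q_h\colon\Delta(E,0)\to\Delta(E,h\sigma)$ be the linear map with $$Q_h(W^0(f))=e^{-\frac h4\|f\|^2}\,W^h(f),\qquad f\in E.$$ Then: (i) $\|Q_h(c)\|_h\le\|c\|_0$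 for every $c\in\Delta(E,0)$; (ii) if $c\in\Delta(E,0)$ is a positive element of $\mathcal W(E,0)$, then $Q_h(c)$ is a positive element of $\mathcal W(E,h\sigma)$. As a consequence, $Q_h$ extends to a unique continuous linear map $Q_h\colon\mathcal W(E,0)\to\mathcal W(E,h\sigma)$, and this extension is a contraction and sends positive elements to positive elements. -/

import Mathlib

open scoped ComplexOrder ComplexConjugate

noncomputable section

variable {H : Type*} [NormedAddCommGroup H] [InnerProductSpace ℂ H]

/-- The symplectic form `σ(f, g) = Im ⟨f, g⟩` on a real linear subspace `E` of a complex inner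
product space (the inner product is linear in the second argument). -/
def weylSigma (E : Submodule ℝ H) (f g : E) : ℝ := (inner ℂ (f : H) (g : H)).im

/-- The Weyl `*`-algebra `Δ(E, hσ)`: the finite complex linear combinations of the Weyl elements
`W^h(f)`, `f ∈ E`, which are linearly independent. Its product and its involution, defined below,
depend on `h`. -/
def WeylStarAlgebra (E : Submodule ℝ H) (_h : ℝ) : Type _ := E →₀ ℂ

namespace WeylStarAlgebra

variable {E : Submodule ℝ H} {h : ℝ}

instance : AddCommGroup (WeylStarAlgebra E h) := inferInstanceAs (AddCommGroup (E →₀ ℂ))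

instance : Module ℂ (WeylStarAlgebra E h) := inferInstanceAs (Module ℂ (E →₀ ℂ))

/-- The coefficients of an element with respect to the Weyl elements. -/
def coeff (a : WeylStarAlgebra E h) : E →₀ ℂ := a

/-- The Weyl element `W^h(f)`. -/
def W (E : Submodule ℝ H) (h : ℝ) (f : E) : WeylStarAlgebra E h := Finsupp.single f (1 : ℂ)

/-- The linear extension of a map that is given on the Weyl elements. -/
def lift {M : Type*} [AddCommGroup M] [Module ℂ M] (v : E → M) : WeylStarAlgebra E h →ₗ[ℂ] M :=
  Finsupp.linearCombination ℂ v

@[simp]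
theorem lift_W {M : Type*} [AddCommGroup M] [Module ℂ M] (v : E → M) (f : E) :
    lift v (W E h f) = v f := by
  change Finsupp.linearCombination ℂ v (Finsupp.single f 1) = v f
  simp

/-- The Weyl elements span. -/
theorem induction_W {p : WeylStarAlgebra E h → Prop} (a : WeylStarAlgebra E h) (h0 : p 0)
    (hadd : ∀ a b, p a → p b → p (a + b)) (hW : ∀ (z : ℂ) (f : E), p (z • W E h f)) : p a := by
  refine Finsupp.induction_linear (motive := p) a h0 hadd fun f z => ?_
  have : (Finsupp.single f z : E →₀ ℂ) = z • Finsupp.single f 1 := by simp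
  rw [this]
  exact hW z f

/-- The phase `exp(-(i/2) h σ(f, g))` of the Weyl relations. -/
def phase (h : ℝ) (f g : E) : ℂ := Complex.exp (-(Complex.I / 2) * (h * weylSigma E f g : ℝ))

/-- The product, as a bilinear map: `W^h(f) W^h(g) = exp(-(i/2) h σ(f, g)) W^h(f + g)`. -/
def mulL : WeylStarAlgebra E h →ₗ[ℂ] WeylStarAlgebra E h →ₗ[ℂ] WeylStarAlgebra E h :=
  lift fun f => lift fun g => phase h f g • W E h (f + g)

instance : Mul (WeylStarAlgebra E h) := ⟨fun a b => mulL a b⟩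

instance : One (WeylStarAlgebra E h) := ⟨W E h 0⟩

/-- The involution is the conjugate linear map with `W^h(f)^* = W^h(-f)`. -/
instance : Star (WeylStarAlgebra E h) :=
  ⟨fun a => Finsupp.equivMapDomain (Equiv.neg E) (Finsupp.mapRange conj (map_zero _) a)⟩

theorem W_mul_W (f g : E) : W E h f * W E h g = phase h f g • W E h (f + g) := by
  change mulL (W E h f) (W E h g) = _
  simp [mulL]

theorem W_zero : W E h 0 = 1 := rfl

theorem star_apply (a : WeylStarAlgebra E h) (f : E) :
    coeff (star a) f = conj (coeff a (-f)) := rfl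

theorem star_W (f : E) : star (W E h f) = W E h (-f) := by
  change Finsupp.equivMapDomain (Equiv.neg E)
    (Finsupp.mapRange conj (map_zero _) (Finsupp.single f 1)) = Finsupp.single (-f) 1
  rw [Finsupp.mapRange_single, Finsupp.equivMapDomain_single]
  simp

theorem weylSigma_add_left (f g k : E) :
    weylSigma E (f + g) k = weylSigma E f k + weylSigma E g k := by
  simp [weylSigma]

theorem weylSigma_add_right (f g k : E) :
    weylSigma E f (g + k) = weylSigma E f g + weylSigma E f k := by
  simp [weylSigma]

theorem weylSigma_neg_neg (f g : E) : weylSigma E (-f) (-g) = weylSigma E f g := by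
  simp [weylSigma]

theorem weylSigma_swap (f g : E) : weylSigma E g f = -weylSigma E f g := by
  rw [weylSigma, weylSigma, ← inner_conj_symm, Complex.conj_im]

theorem weylSigma_self (f : E) : weylSigma E f f = 0 := by
  have := weylSigma_swap f f
  linarith

theorem weylSigma_zero_left (f : E) : weylSigma E 0 f = 0 := by simp [weylSigma]

theorem weylSigma_zero_right (f : E) : weylSigma E f 0 = 0 := by simp [weylSigma]

theorem weylSigma_neg_left_self (f : E) : weylSigma E (-f) f = 0 := by
  have h1 := weylSigma_self f
  simp only [weylSigma] at h1 ⊢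
  simpa using h1

theorem mul_add' (a b c : WeylStarAlgebra E h) : a * (b + c) = a * b + a * c :=
  map_add (mulL a) b c

theorem add_mul' (a b c : WeylStarAlgebra E h) : (a + b) * c = a * c + b * c := by
  change mulL (a + b) c = mulL a c + mulL b c
  simp

theorem zero_mul' (a : WeylStarAlgebra E h) : 0 * a = 0 := by
  change mulL 0 a = 0
  simp

theorem mul_zero' (a : WeylStarAlgebra E h) : a * 0 = 0 := map_zero (mulL a)

theorem smul_mul' (z : ℂ) (a b : WeylStarAlgebra E h) : (z • a) * b = z • (a * b) := by
  change mulL (z • a) b = z • mulL a b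
  simp

theorem mul_smul' (z : ℂ) (a b : WeylStarAlgebra E h) : a * (z • b) = z • (a * b) :=
  map_smul (mulL a) z b

theorem one_mul' (a : WeylStarAlgebra E h) : 1 * a = a := by
  induction a using induction_W with
  | h0 => exact mul_zero' _
  | hadd a b ha hb => rw [mul_add', ha, hb]
  | hW z f => rw [mul_smul', ← W_zero, W_mul_W]; simp [phase, weylSigma_zero_left]

theorem mul_one' (a : WeylStarAlgebra E h) : a * 1 = a := by
  induction a using induction_W with
  | h0 => exact zero_mul' _
  | hadd a b ha hb => rw [add_mul', ha, hb]
  | hW z f => rw [smul_mul', ← W_zero, W_mul_W]; simp [phase, weylSigma_zero_right]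

theorem mul_assoc' (a b c : WeylStarAlgebra E h) : a * b * c = a * (b * c) := by
  induction a using induction_W with
  | h0 => simp only [zero_mul']
  | hadd a b ha hb => simp only [add_mul', ha, hb]
  | hW x f =>
    induction b using induction_W with
    | h0 => simp only [zero_mul', mul_zero']
    | hadd a b ha hb => simp only [add_mul', mul_add', ha, hb]
    | hW y g =>
      induction c using induction_W with
      | h0 => simp only [mul_zero']
      | hadd a b ha hb => simp only [mul_add', ha, hb]
      | hW z k =>
        have : phase h f g * phase h (f + g) k = phase h g k * phase h f (g + k) := by
          simp only [phase, ← Complex.exp_add, weylSigma_add_left, weylSigma_add_right]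
          congr 1
          push_cast
          ring
        simp only [smul_mul', mul_smul', W_mul_W, smul_smul, add_assoc]
        congr 1
        linear_combination z * y * x * this

instance : Ring (WeylStarAlgebra E h) where
  __ := (inferInstance : AddCommGroup (WeylStarAlgebra E h))
  mul := (· * ·)
  one := 1
  left_distrib := mul_add'
  right_distrib := add_mul'
  zero_mul := zero_mul'
  mul_zero := mul_zero'
  mul_assoc := mul_assoc'
  one_mul := one_mul'
  mul_one := mul_one'

instance : Algebra ℂ (WeylStarAlgebra E h) := Algebra.ofModule smul_mul' mul_smul'

theorem star_add' (a b : WeylStarAlgebra E h) : star (a + b) = star a + star b := by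
  refine Finsupp.ext (M := ℂ) fun f => ?_
  exact map_add conj _ _

theorem star_smul' (z : ℂ) (a : WeylStarAlgebra E h) : star (z • a) = conj z • star a := by
  refine Finsupp.ext (M := ℂ) fun f => ?_
  exact map_mul conj _ _

theorem star_mul' (a b : WeylStarAlgebra E h) : star (a * b) = star b * star a := by
  have h0 : star (0 : WeylStarAlgebra E h) = 0 := by
    simpa using star_smul' (0 : ℂ) (0 : WeylStarAlgebra E h)
  induction a using induction_W with
  | h0 => simp only [zero_mul, h0, mul_zero]
  | hadd a b ha hb => simp only [add_mul, mul_add, star_add', ha, hb]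
  | hW x f =>
    induction b using induction_W with
    | h0 => simp only [zero_mul, h0, mul_zero]
    | hadd a b ha hb => simp only [add_mul, mul_add, star_add', ha, hb]
    | hW y g =>
      have : conj (phase h f g) = phase h (-g) (-f) := by
        simp only [phase, weylSigma_neg_neg, ← Complex.exp_conj]
        rw [weylSigma_swap f g]
        simp [neg_div, Complex.conj_ofNat]
      simp only [smul_mul', mul_smul', W_mul_W, smul_smul, star_smul', star_W, this, neg_add_rev,
        map_mul]
      congr 1
      ring

instance : StarRing (WeylStarAlgebra E h) where
  star_involutive a := by
    refine Finsupp.ext (M := ℂ) fun f => ?_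
    change conj (conj (coeff a (- -f))) = coeff a f
    rw [neg_neg, Complex.conj_conj]
  star_mul := star_mul'
  star_add := star_add'

instance : StarModule ℂ (WeylStarAlgebra E h) := ⟨star_smul'⟩

/-- The states of `Δ(E, hσ)`. -/
structure State (E : Submodule ℝ H) (h : ℝ) where
  /-- The underlying linear functional. -/
  toLin : WeylStarAlgebra E h →ₗ[ℂ] ℂ
  nonneg : ∀ a, 0 ≤ toLin (star a * a)
  map_one : toLin 1 = 1

/-- `ω(a^* a)^{1/2}`. -/
def State.semi (ω : State E h) (a : WeylStarAlgebra E h) : ℝ := √(ω.toLin (star a * a)).re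

/-- The norm `‖a‖_h = sup {ω(a^* a)^{1/2} : ω a state of Δ(E, hσ)}`. -/
instance : Norm (WeylStarAlgebra E h) := ⟨fun a => ⨆ ω : State E h, ω.semi a⟩

theorem norm_def (a : WeylStarAlgebra E h) : ‖a‖ = ⨆ ω : State E h, ω.semi a := rfl

/-! The rest of this section shows that this is a `C*`-norm. -/

theorem State.map_star (ω : State E h) (c : WeylStarAlgebra E h) :
    ω.toLin (star c) = conj (ω.toLin c) := by
  have h1 := (Complex.le_def.1 (ω.nonneg 1)).2
  have hc := (Complex.le_def.1 (ω.nonneg c)).2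
  have h2 := (Complex.le_def.1 (ω.nonneg (1 + c))).2
  have h3 := (Complex.le_def.1 (ω.nonneg (1 + Complex.I • c))).2
  simp only [star_add, star_one, star_smul, add_mul, mul_add, one_mul, mul_one, smul_mul_assoc,
    mul_smul_comm, map_add, map_smul, Complex.add_im, smul_eq_mul, Complex.zero_im,
    Complex.mul_im, Complex.I_re, Complex.I_im, Complex.star_def, Complex.conj_I, Complex.neg_re,
    Complex.neg_im, ω.map_one, Complex.one_im, Complex.mul_re] at h1 hc h2 h3
  apply Complex.ext
  · rw [Complex.conj_re]; linarith
  · rw [Complex.conj_im]; linarith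

/-- The semi-inner product `ω(a^* b)`. -/
@[reducible]
def State.core (ω : State E h) : PreInnerProductSpace.Core ℂ (WeylStarAlgebra E h) where
  inner a b := ω.toLin (star a * b)
  conj_inner_symm a b := by rw [← ω.map_star]; simp
  re_inner_nonneg a := (Complex.le_def.1 (ω.nonneg a)).1
  add_left a b c := by simp [add_mul]
  smul_left a b z := by simp

theorem State.semi_nonneg (ω : State E h) (a : WeylStarAlgebra E h) : 0 ≤ ω.semi a :=
  Real.sqrt_nonneg _

theorem State.semi_sq (ω : State E h) (a : WeylStarAlgebra E h) :
    ω.semi a ^ 2 = (ω.toLin (star a * a)).re :=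
  Real.sq_sqrt (Complex.le_def.1 (ω.nonneg a)).1

theorem State.semi_add (ω : State E h) (a b : WeylStarAlgebra E h) :
    ω.semi (a + b) ≤ ω.semi a + ω.semi b := by
  let := ω.core
  let := InnerProductSpace.Core.toSeminormedAddCommGroup (𝕜 := ℂ) (F := WeylStarAlgebra E h)
  exact norm_add_le a b

theorem State.cauchy_schwarz (ω : State E h) (a b : WeylStarAlgebra E h) :
    ‖ω.toLin (star a * b)‖ ≤ ω.semi a * ω.semi b := by
  let := ω.core
  exact InnerProductSpace.Core.norm_inner_le_norm (𝕜 := ℂ) (F := WeylStarAlgebra E h) a b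

theorem State.semi_smul (ω : State E h) (z : ℂ) (a : WeylStarAlgebra E h) :
    ω.semi (z • a) = ‖z‖ * ω.semi a := by
  have : ω.toLin (star (z • a) * (z • a)) = ((‖z‖ ^ 2 : ℝ) : ℂ) * ω.toLin (star a * a) := by
    simp only [star_smul, smul_mul_assoc, mul_smul_comm, map_smul, smul_eq_mul, ← mul_assoc]
    rw [Complex.star_def, mul_comm z, Complex.conj_mul', Complex.ofReal_pow]
  rw [State.semi, this, Complex.re_ofReal_mul, Real.sqrt_mul (sq_nonneg _),
    Real.sqrt_sq (norm_nonneg _), State.semi]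

theorem State.semi_W (ω : State E h) (f : E) : ω.semi (W E h f) = 1 := by
  have : star (W E h f) * W E h f = 1 := by
    rw [star_W, W_mul_W, phase, weylSigma_neg_left_self, ← W_zero]
    simp
  rw [State.semi, this, ω.map_one]
  simp

theorem State.semi_one (ω : State E h) : ω.semi 1 = 1 := ω.semi_W 0

theorem bddAbove_semi (a : WeylStarAlgebra E h) :
    BddAbove (Set.range fun ω : State E h => ω.semi a) := by
  induction a using induction_W with
  | h0 =>
    refine ⟨0, ?_⟩
    rintro _ ⟨ω, rfl⟩
    simp [State.semi]
  | hadd a b ha hb =>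
    obtain ⟨A, hA⟩ := ha
    obtain ⟨B, hB⟩ := hb
    refine ⟨A + B, ?_⟩
    rintro _ ⟨ω, rfl⟩
    exact (ω.semi_add a b).trans (add_le_add (hA ⟨ω, rfl⟩) (hB ⟨ω, rfl⟩))
  | hW z f =>
    refine ⟨‖z‖, ?_⟩
    rintro _ ⟨ω, rfl⟩
    simp [ω.semi_smul, ω.semi_W]

theorem State.semi_le_norm (ω : State E h) (a : WeylStarAlgebra E h) : ω.semi a ≤ ‖a‖ :=
  le_ciSup (bddAbove_semi a) ω

/-- Evaluation of the coefficient of `W^h(0)`. -/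
def coeffZero : WeylStarAlgebra E h →ₗ[ℂ] ℂ := lift fun f => open Classical in if f = 0 then 1 else 0

theorem coeffZero_star_mul_self (a : WeylStarAlgebra E h) :
    coeffZero (star a * a) = Finsupp.sum (coeff a) fun _ z => ((‖z‖ ^ 2 : ℝ) : ℂ) := by
  have key : ∀ b c : WeylStarAlgebra E h, coeffZero (star b * c) =
      Finsupp.sum (coeff c) fun f z => conj ((coeff b) f) * z := by
    intro b c
    refine induction_W (p := fun c => coeffZero (star b * c) =
      Finsupp.sum (coeff c) fun f z => conj ((coeff b) f) * z) c ?_ ?_ ?_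
    · rw [mul_zero, map_zero]; rfl
    · intro c d hc hd
      rw [mul_add, map_add, hc, hd]
      exact (Finsupp.sum_add_index' (f := (coeff c)) (g := (coeff d))
        (h := fun f z => conj ((coeff b) f) * z)
        (by simp) (by intros; ring)).symm
    · intro z g
      have hz : coeff (z • W E h g) = Finsupp.single g z := by
        change z • Finsupp.single g (1 : ℂ) = _
        simp
      rw [hz, Finsupp.sum_single_index (by simp), mul_smul_comm, map_smul, smul_eq_mul, mul_comm]
      congr 1
      refine induction_W (p := fun b => coeffZero (star b * W E h g) =
        conj ((coeff b) g)) b ?_ ?_ ?_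
      · rw [star_zero, zero_mul, map_zero]
        exact (map_zero conj).symm
      · intro b d hb hd
        rw [star_add, add_mul, map_add, hb, hd]
        exact (map_add conj _ _).symm
      · intro y f
        have hy : coeff (y • W E h f) = Finsupp.single f y := by
          change y • Finsupp.single f (1 : ℂ) = _
          simp
        rw [hy, star_smul, smul_mul_assoc, map_smul, star_W, W_mul_W, map_smul, coeffZero, lift_W]
        by_cases hfg : f = g
        · subst hfg
          simp [phase, weylSigma_neg_left_self]
        · have : -f + g ≠ 0 := fun h0 => hfg (neg_add_eq_zero.1 h0)
          simp [this, hfg]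
  rw [key]
  refine Finsupp.sum_congr fun f _ => ?_
  rw [Complex.conj_mul', Complex.ofReal_pow]

/-- The canonical central state. -/
def centralState (E : Submodule ℝ H) (h : ℝ) : State E h where
  toLin := coeffZero
  nonneg a := by
    rw [coeffZero_star_mul_self]
    exact Finset.sum_nonneg fun f _ => Complex.zero_le_real.2 (sq_nonneg _)
  map_one := by
    rw [← W_zero, coeffZero, lift_W]
    simp

instance : Nonempty (State E h) := ⟨centralState E h⟩

theorem eq_zero_of_norm_eq_zero (a : WeylStarAlgebra E h) (ha : ‖a‖ = 0) : a = 0 := by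
  have h1 : (centralState E h).semi a = 0 :=
    le_antisymm (ha ▸ (centralState E h).semi_le_norm a) ((centralState E h).semi_nonneg a)
  have h2 := (centralState E h).semi_sq a
  rw [h1] at h2
  change _ = (coeffZero (star a * a)).re at h2
  rw [coeffZero_star_mul_self, Finsupp.sum, ← Complex.ofReal_sum, Complex.ofReal_re, eq_comm] at h2
  simp only [ne_eq, OfNat.ofNat_ne_zero, not_false_eq_true, zero_pow] at h2
  rw [Finset.sum_eq_zero_iff_of_nonneg fun f _ => sq_nonneg _] at h2
  refine Finsupp.ext (M := ℂ) fun f => ?_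
  by_contra hf
  have := h2 f (Finsupp.mem_support_iff.2 hf)
  simp only [ne_eq, OfNat.ofNat_ne_zero, not_false_eq_true, pow_eq_zero_iff, norm_eq_zero] at this
  exact hf this

instance : NormedAddCommGroup (WeylStarAlgebra E h) :=
  AddGroupNorm.toNormedAddCommGroup
    { toFun := fun a => ‖a‖
      map_zero' := by simp [norm_def, State.semi]
      add_le' := fun a b => ciSup_le fun ω =>
        (ω.semi_add a b).trans (add_le_add (ω.semi_le_norm a) (ω.semi_le_norm b))
      neg' := fun a => by simp [norm_def, State.semi]
      eq_zero_of_map_eq_zero' := eq_zero_of_norm_eq_zero }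

theorem State.semi_mul (ω : State E h) (a b : WeylStarAlgebra E h) :
    ω.semi (a * b) ≤ ‖a‖ * ω.semi b := by
  have hab : star (a * b) * (a * b) = star b * (star a * a * b) := by
    rw [star_mul]; simp only [mul_assoc]
  rcases (ω.semi_nonneg b).eq_or_lt with hb | hb
  · have h1 := ω.cauchy_schwarz b (star a * a * b)
    rw [← hb, zero_mul, ← hab, norm_le_zero_iff] at h1
    rw [← hb, mul_zero, State.semi, h1]
    simp
  · have hre : ω.toLin (star b * b) = ((ω.semi b ^ 2 : ℝ) : ℂ) := by
      rw [ω.semi_sq]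
      exact Complex.ext rfl (Complex.le_def.1 (ω.nonneg b)).2.symm
    have hpos : 0 < ω.semi b ^ 2 := by positivity
    let ω' : State E h :=
      { toLin :=
          { toFun := fun c => (((ω.semi b ^ 2)⁻¹ : ℝ) : ℂ) * ω.toLin (star b * (c * b))
            map_add' := fun c d => by simp only [add_mul, mul_add, map_add]
            map_smul' := fun z c => by
              simp only [smul_mul_assoc, mul_smul_comm, map_smul, smul_eq_mul, RingHom.id_apply]
              ring }
        nonneg := fun c => by
          have : star b * (star c * c * b) = star (c * b) * (c * b) := by
            rw [star_mul]; simp only [mul_assoc]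
          simp only [LinearMap.coe_mk, AddHom.coe_mk, this]
          exact mul_nonneg (Complex.zero_le_real.2 (inv_nonneg.2 hpos.le)) (ω.nonneg _)
        map_one := by
          simp only [LinearMap.coe_mk, AddHom.coe_mk, one_mul, hre]
          rw [← Complex.ofReal_mul, inv_mul_cancel₀ hpos.ne', Complex.ofReal_one] }
    have h1 : ω'.semi a ≤ ‖a‖ := ω'.semi_le_norm a
    have h2 : ω'.semi a ^ 2 = (ω.semi b ^ 2)⁻¹ * ω.semi (a * b) ^ 2 := by
      rw [ω'.semi_sq, ω.semi_sq (a * b), hab]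
      exact Complex.re_ofReal_mul _ _
    refine abs_le_of_sq_le_sq' ?_ (mul_nonneg (norm_nonneg a) hb.le) |>.2
    have h3 : ω'.semi a ^ 2 ≤ ‖a‖ ^ 2 := pow_le_pow_left₀ (ω'.semi_nonneg a) h1 2
    rw [h2, inv_mul_le_iff₀ hpos] at h3
    linarith [mul_pow ‖a‖ (ω.semi b) 2]

instance : NormedRing (WeylStarAlgebra E h) where
  __ := (inferInstance : NormedAddCommGroup (WeylStarAlgebra E h))
  __ := (inferInstance : Ring (WeylStarAlgebra E h))
  norm_mul_le a b := ciSup_le fun ω => (ω.semi_mul a b).trans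
    (mul_le_mul_of_nonneg_left (ω.semi_le_norm b) (norm_nonneg a))

instance : CStarRing (WeylStarAlgebra E h) where
  norm_mul_self_le a := by
    have h1 : ∀ ω : State E h, ω.semi a ≤ √‖star a * a‖ := fun ω => by
      apply Real.le_sqrt_of_sq_le
      have h2 := ω.cauchy_schwarz 1 (star a * a)
      rw [star_one, one_mul, ω.semi_one, one_mul] at h2
      rw [ω.semi_sq]
      exact (Complex.re_le_norm _).trans (h2.trans (ω.semi_le_norm _))
    have h3 : ‖a‖ ≤ √‖star a * a‖ := ciSup_le h1
    exact (mul_self_le_mul_self (norm_nonneg a) h3).trans (Real.mul_self_sqrt (norm_nonneg _)).le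

instance : NormedAlgebra ℂ (WeylStarAlgebra E h) where
  norm_smul_le z a := ciSup_le fun ω => by
    rw [ω.semi_smul]
    exact mul_le_mul_of_nonneg_left (ω.semi_le_norm a) (norm_nonneg z)

end WeylStarAlgebra

/-- The Weyl `C*`-algebra `𝒲(E, hσ)`: the completion of `Δ(E, hσ)` in the norm `‖·‖_h`. -/
def WeylCStarAlgebra (E : Submodule ℝ H) (h : ℝ) : Type _ :=
  UniformSpace.Completion (WeylStarAlgebra E h)

namespace WeylCStarAlgebra

open UniformSpace

variable {E : Submodule ℝ H} {h : ℝ}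

instance : NormedRing (WeylCStarAlgebra E h) :=
  inferInstanceAs (NormedRing (Completion (WeylStarAlgebra E h)))

instance : CompleteSpace (WeylCStarAlgebra E h) :=
  inferInstanceAs (CompleteSpace (Completion (WeylStarAlgebra E h)))

instance : Algebra ℂ (WeylCStarAlgebra E h) :=
  inferInstanceAs (Algebra ℂ (Completion (WeylStarAlgebra E h)))

instance : NormedAlgebra ℂ (WeylCStarAlgebra E h) where
  norm_smul_le := norm_smul_le (α := ℂ) (β := Completion (WeylStarAlgebra E h))

/-- The canonical map `Δ(E, hσ) → 𝒲(E, hσ)`, as a function. -/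
def of (a : WeylStarAlgebra E h) : WeylCStarAlgebra E h := (a : Completion (WeylStarAlgebra E h))

/-- The involution is the continuous extension of that of `Δ(E, hσ)`. -/
instance : Star (WeylCStarAlgebra E h) :=
  ⟨Completion.map (star : WeylStarAlgebra E h → WeylStarAlgebra E h)⟩

theorem continuous_star' : Continuous (star : WeylCStarAlgebra E h → WeylCStarAlgebra E h) :=
  Completion.continuous_map

theorem star_of (a : WeylStarAlgebra E h) : star (of a) = of (star a) :=
  Completion.map_coe (starₗᵢ ℂ (E := WeylStarAlgebra E h)).isometry.uniformContinuous a

theorem of_mul (a b : WeylStarAlgebra E h) : of (a * b) = of a * of b := Completion.coe_mul a b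

theorem of_add (a b : WeylStarAlgebra E h) : of (a + b) = of a + of b := Completion.coe_add a b

theorem of_smul (z : ℂ) (a : WeylStarAlgebra E h) : of (z • a) = z • of a :=
  Completion.coe_smul z a

theorem norm_of (a : WeylStarAlgebra E h) : ‖of a‖ = ‖a‖ := Completion.norm_coe a

theorem continuous_of : Continuous (of : WeylStarAlgebra E h → WeylCStarAlgebra E h) :=
  Completion.continuous_coe _

theorem denseRange_of : DenseRange (of : WeylStarAlgebra E h → WeylCStarAlgebra E h) :=
  Completion.denseRange_coe

instance : StarRing (WeylCStarAlgebra E h) where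
  star_involutive a := by
    refine denseRange_of.induction_on a
      (isClosed_eq (continuous_star'.comp continuous_star') continuous_id) fun a => ?_
    rw [star_of, star_of, star_star]
  star_mul a b := by
    refine denseRange_of.induction_on₂ (p := fun a b => star (a * b) = star b * star a)
      (isClosed_eq (continuous_star'.comp continuous_mul)
        ((continuous_star'.comp continuous_snd).mul (continuous_star'.comp continuous_fst)))
      (fun a b => ?_) a b
    rw [← of_mul, star_of, star_of, star_of, star_mul, of_mul]
  star_add a b := by
    refine denseRange_of.induction_on₂ (p := fun a b => star (a + b) = star a + star b)
      (isClosed_eq (continuous_star'.comp continuous_add)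
        ((continuous_star'.comp continuous_fst).add (continuous_star'.comp continuous_snd)))
      (fun a b => ?_) a b
    rw [← of_add, star_of, star_of, star_of, star_add, of_add]

instance : CStarAlgebra (WeylCStarAlgebra E h) where
  norm_mul_self_le a := by
    refine denseRange_of.induction_on a
      (isClosed_le (continuous_norm.mul continuous_norm)
        (continuous_norm.comp (continuous_star'.mul continuous_id))) fun a => ?_
    change ‖of a‖ * ‖of a‖ ≤ ‖star (of a) * of a‖
    rw [star_of, ← of_mul, norm_of, norm_of]
    exact CStarRing.norm_mul_self_le a
  star_smul z a := by
    refine denseRange_of.induction_on a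
      (isClosed_eq (continuous_star'.comp (continuous_const_smul z))
        (continuous_star'.const_smul (star z))) fun a => ?_
    rw [← of_smul, star_of, star_of, ← of_smul, star_smul]

/-- The order of a `C*`-algebra: `0 ≤ a` if and only if `a` is a positive element, that is,
self-adjoint with non-negative spectrum. -/
instance : PartialOrder (WeylCStarAlgebra E h) := CStarAlgebra.spectralOrder _

instance : StarOrderedRing (WeylCStarAlgebra E h) := CStarAlgebra.spectralOrderedRing _

end WeylCStarAlgebra

/-- The canonical embedding of the `*`-algebra `Δ(E, hσ)` into its completion `𝒲(E, hσ)`. -/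
def WeylStarAlgebra.toCStar (E : Submodule ℝ H) (h : ℝ) :
    WeylStarAlgebra E h →⋆ₐ[ℂ] WeylCStarAlgebra E h where
  toFun := WeylCStarAlgebra.of
  map_one' := rfl
  map_mul' := WeylCStarAlgebra.of_mul
  map_zero' := rfl
  map_add' := WeylCStarAlgebra.of_add
  commutes' _ := rfl
  map_star' a := (WeylCStarAlgebra.star_of a).symm

/-- The abstract quantization map `Q_h : Δ(E, 0) → Δ(E, hσ)`: the linear map with
`Q_h(W^0(f)) = exp(-h ‖f‖² / 4) W^h(f)`. -/
def weylQuantization (E : Submodule ℝ H) (h : ℝ) :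
    WeylStarAlgebra E 0 →ₗ[ℂ] WeylStarAlgebra E h :=
  WeylStarAlgebra.lift fun f => (Real.exp (-(h / 4) * ‖f‖ ^ 2) : ℂ) • WeylStarAlgebra.W E h f

end

/-! The phase of the Weyl relations and the Gaussian factor of `weylQuantization` combine into one
exponential: writing Q for the quantization map, Q(W(f)^* W(g)) = exp((h/2)⟨g, f⟩) Q(W(f))^*
Q(W(g)). The exponent is, for h ≥ 0, a positive semidefinite kernel, and by the Schur product
theorem so is its entrywise exponential minus 1. Hence, for every d in Δ(E, 0), Q(d^* d) equals
Q(d)^* Q(d) plus a finite sum of hermitian squares (`exists_weylQuantization_star_mul_self`), an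
identity inside the algebra Δ(E, hσ).

Both claims follow. For a state ω, the functional ω ∘ Q is again a state, and ω(Q(c)^* Q(c)) ≤ (ω ∘
Q)(c^* c) ≤ ‖c‖²; taking the supremum over ω gives the contraction, hence the continuous extension.
The extension is positive on all d^* d, and these approximate every positive element b^* b of the
completion. -/

/-! ### Entrywise exponentials of positive semidefinite matrices. -/

namespace Matrix.PosSemidef

open scoped Matrix

/-- Entrywise powers of a positive semidefinite matrix are positive semidefinite. -/
theorem map_pow_succ {n : Type*} {M : Matrix n n ℂ} (hM : M.PosSemidef) (k : ℕ) :
    (M.map fun z => z ^ (k + 1)).PosSemidef := by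
  induction k with
  | zero => simpa using hM
  | succ k ih =>
    -- The Schur product theorem drives the induction.
    have : (M.map fun z => z ^ (k + 1 + 1)) = (M.map fun z => z ^ (k + 1)) ⊙ M := by
      ext i j
      simp [pow_succ]
    rw [this]
    exact ih.hadamard hM

/-- If `M` is positive semidefinite, then so is the matrix with entries `exp (M i j) - 1`. -/
theorem map_exp_sub_one {n : Type*} [Fintype n] {M : Matrix n n ℂ} (hM : M.PosSemidef) :
    (M.map fun z => Complex.exp z - 1).PosSemidef := by
  refine .of_dotProduct_mulVec_nonneg ?_ fun x => ?_
  · ext i j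
    have := hM.isHermitian.apply i j
    simp only [conjTranspose_apply, map_apply, star_sub, star_one, Complex.star_def] at this ⊢
    rw [← Complex.exp_conj, this]
  · have hexp (z : ℂ) : HasSum (fun k : ℕ => ((k + 1).factorial : ℂ)⁻¹ * z ^ (k + 1))
        (Complex.exp z - 1) := by
      have h0 := NormedSpace.expSeries_div_hasSum_exp (𝔸 := ℂ) z
      -- Removing the constant term of the series accounts for the `- 1`, so only powers of exponent
      -- at least 1 occur.
      rw [← Complex.exp_eq_exp_ℂ, ← hasSum_nat_add_iff' 1] at h0
      simpa [div_eq_inv_mul] using h0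
    have hs : HasSum (fun k : ℕ => ((k + 1).factorial : ℂ)⁻¹ *
        (star x ⬝ᵥ (M.map fun z => z ^ (k + 1)) *ᵥ x))
        (star x ⬝ᵥ (M.map fun z => Complex.exp z - 1) *ᵥ x) := by
      simp only [dotProduct, mulVec, Finset.mul_sum]
      refine hasSum_sum fun i _ => hasSum_sum fun j _ => ?_
      have hij := ((hexp (M i j)).mul_right (x j)).mul_left (star x i)
      refine (funext fun k => ?_ : _ = fun k : ℕ => _) ▸ hij
      rw [map_apply]
      ring
    refine hs.nonneg fun k => mul_nonneg ?_ ((hM.map_pow_succ k).dotProduct_mulVec_nonneg x)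
    rw [← Complex.ofReal_natCast, ← Complex.ofReal_inv, Complex.zero_le_real]
    positivity

/-- A positive semidefinite matrix turns a family into a sum of hermitian squares. -/
theorem exists_sum_smul_star_mul_eq {n A : Type*} [Fintype n] [Ring A] [StarRing A] [Algebra ℂ A]
    [StarModule ℂ A] {M : Matrix n n ℂ} (hM : M.PosSemidef) (b : n → A) :
    ∃ (m : ℕ) (v : Fin m → A),
      ∑ i, ∑ j, M i j • (star (b i) * b j) = ∑ r, star (v r) * v r := by
  obtain ⟨m, u, rfl⟩ := posSemidef_iff_eq_sum_vecMulVec.1 hM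
  -- Since M is the sum of the rank-one matrices u_r u_r^*, the conjugate on `u r j` makes the (i,
  -- j) coefficient of v_r^* v_r equal to `u r i * conj (u r j)`.
  refine ⟨m, fun r => ∑ j, conj (u r j) • b j, ?_⟩
  simp only [sum_apply, vecMulVec_apply, Finset.sum_smul, star_sum, star_smul, Finset.sum_mul,
    Finset.mul_sum, smul_mul_assoc, mul_smul_comm, Finset.smul_sum]
  rw [Finset.sum_congr rfl fun i _ => Finset.sum_comm, Finset.sum_comm]
  refine Finset.sum_congr rfl fun r _ => ?_
  rw [Finset.sum_comm]
  refine Finset.sum_congr rfl fun i _ => Finset.sum_congr rfl fun j _ => ?_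
  rw [smul_smul, mul_comm (u r j)]
  simp

end Matrix.PosSemidef

/-! ### The Kadison-Schwarz inequality and the contraction property on Δ(E, 0). -/

namespace WeylStarAlgebra

variable {H : Type*} [NormedAddCommGroup H] [InnerProductSpace ℂ H]
variable {E : Submodule ℝ H} {h : ℝ}

theorem weylQuantization_W (f : E) : weylQuantization E h (W E 0 f) =
    (Real.exp (-(h / 4) * ‖f‖ ^ 2) : ℂ) • W E h f :=
  lift_W _ f

theorem weylQuantization_one : weylQuantization E h 1 = 1 := by
  rw [← W_zero, weylQuantization_W, ← W_zero]
  simp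

/-- Every element is a linear combination of finitely many Weyl elements. -/
theorem exists_eq_sum_smul_W (d : WeylStarAlgebra E h) :
    ∃ (s : Finset E) (c : s → ℂ), d = ∑ f, c f • W E h f := by
  refine ⟨(coeff d).support, fun f => coeff d f, ?_⟩
  rw [Finset.sum_coe_sort (coeff d).support fun f => coeff d f • W E h f]
  refine ((coeff d).sum_single.symm.trans (Finset.sum_congr rfl fun f _ => ?_) : coeff d = _)
  change _ = coeff d f • Finsupp.single f (1 : ℂ)
  simp

/-- Expanding ‖g - f‖² leaves the cross term (h/2) Re⟨f, g⟩ in the Gaussian, while the Weyl phase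
contributes -(i h/2) Im⟨f, g⟩; together they are (h/2)⟨g, f⟩. -/
theorem weylQuantization_star_W_mul_W (f g : E) :
    weylQuantization E h (star (W E 0 f) * W E 0 g) =
      Complex.exp (h / 2 * inner ℂ (g : H) (f : H)) •
        (star (weylQuantization E h (W E 0 f)) * weylQuantization E h (W E 0 g)) := by
  have hn : ‖-f + g‖ ^ 2 = ‖f‖ ^ 2 + ‖g‖ ^ 2 - 2 * (inner ℂ (f : H) (g : H)).re := by
    have := norm_sub_sq (𝕜 := ℂ) (g : H) (f : H)
    rw [← inner_conj_symm (f : H) (g : H), Complex.conj_re, neg_add_eq_sub]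
    simp only [RCLike.re_eq_complex_re] at this
    simp only [Submodule.coe_norm, Submodule.coe_sub]
    linarith
  have hσ : weylSigma E (-f) g = -(inner ℂ (f : H) (g : H)).im := by simp [weylSigma]
  have hi : inner ℂ (g : H) (f : H) = (inner ℂ (f : H) (g : H)).re -
      (inner ℂ (f : H) (g : H)).im * Complex.I := by
    rw [← inner_conj_symm (g : H) (f : H)]
    apply Complex.ext <;> simp [-inner_conj_symm]
  simp only [weylQuantization_W, star_smul, star_W, W_mul_W, map_smul, smul_mul_assoc,
    mul_smul_comm, smul_smul, phase, hn, hσ, hi, Complex.star_def, Complex.conj_ofReal]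
  congr 1
  simp only [Complex.ofReal_exp, ← Complex.exp_add]
  congr 1
  push_cast
  ring

/-- The Kadison-Schwarz inequality for the quantization map, with the difference of the two sides
written as a sum of hermitian squares. -/
theorem exists_weylQuantization_star_mul_self (hh : 0 ≤ h) (d : WeylStarAlgebra E 0) :
    ∃ (m : ℕ) (v : Fin m → WeylStarAlgebra E h), weylQuantization E h (star d * d) =
      star (weylQuantization E h d) * weylQuantization E h d + ∑ r, star (v r) * v r := by
  obtain ⟨s, c, rfl⟩ := exists_eq_sum_smul_W d
  -- The entry at (f, g) is ⟨g, f⟩, so this is a multiple of the transposed Gram matrix; the factor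
  -- h/2 is where `0 ≤ h` enters.
  have hM : (Matrix.of fun f g : s =>
      (h / 2 : ℂ) * inner ℂ ((g : E) : H) ((f : E) : H)).PosSemidef := by
    have h2 : (0 : ℂ) ≤ h / 2 := by
      rw [← Complex.ofReal_ofNat, ← Complex.ofReal_div, Complex.zero_le_real]
      positivity
    exact (Matrix.posSemidef_gram ℂ fun f : s => ((f : E) : H)).transpose.smul h2
  -- The 1 subtracted from each entry corresponds to the double sum for Q(d)^* Q(d), which is split
  -- off.
  obtain ⟨m, v, hv⟩ := hM.map_exp_sub_one.exists_sum_smul_star_mul_eq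
    fun f => c f • weylQuantization E h (W E 0 f)
  refine ⟨m, v, ?_⟩
  rw [← hv]
  simp only [map_sum, star_sum, Finset.sum_mul_sum, map_smul, star_smul, smul_mul_assoc,
    mul_smul_comm, weylQuantization_star_W_mul_W, ← Finset.sum_add_distrib, Matrix.map_apply,
    Matrix.of_apply, sub_smul, one_smul]
  refine Finset.sum_congr rfl fun f _ => Finset.sum_congr rfl fun g _ => ?_
  module

/-- The pull-back of a state along the quantization map is a state. -/
noncomputable def State.quantization (hh : 0 ≤ h) (ω : State E h) : State E 0 where
  toLin := ω.toLin ∘ₗ weylQuantization E h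
  nonneg a := by
    obtain ⟨m, v, hv⟩ := exists_weylQuantization_star_mul_self hh a
    rw [LinearMap.comp_apply, hv, map_add, map_sum]
    exact add_nonneg (ω.nonneg _) (Finset.sum_nonneg fun r _ => ω.nonneg _)
  map_one := by rw [LinearMap.comp_apply, weylQuantization_one, ω.map_one]

/-- The hermitian squares in the Kadison-Schwarz identity have non-negative expectation under ω and
can be dropped. -/
theorem State.semi_weylQuantization_le (hh : 0 ≤ h) (ω : State E h) (c : WeylStarAlgebra E 0) :
    ω.semi (weylQuantization E h c) ≤ (ω.quantization hh).semi c := by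
  obtain ⟨m, v, hv⟩ := exists_weylQuantization_star_mul_self hh c
  refine Real.sqrt_le_sqrt (Complex.le_def.1 ?_).1
  change _ ≤ ω.toLin (weylQuantization E h (star c * c))
  rw [hv, map_add, map_sum]
  exact le_add_of_nonneg_right (Finset.sum_nonneg fun r _ => ω.nonneg _)

theorem norm_weylQuantization_le (hh : 0 ≤ h) (c : WeylStarAlgebra E 0) :
    ‖weylQuantization E h c‖ ≤ ‖c‖ :=
  ciSup_le fun ω => (ω.semi_weylQuantization_le hh c).trans (State.semi_le_norm _ c)

theorem toCStar_weylQuantization_star_mul_self_nonneg (hh : 0 ≤ h) (d : WeylStarAlgebra E 0) :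
    0 ≤ toCStar E h (weylQuantization E h (star d * d)) := by
  obtain ⟨m, v, hv⟩ := exists_weylQuantization_star_mul_self hh d
  simp only [hv, map_add, map_sum, map_mul, map_star]
  exact add_nonneg (star_mul_self_nonneg _) (Finset.sum_nonneg fun r _ => star_mul_self_nonneg _)

theorem denseRange_toCStar : DenseRange (toCStar E h) := WeylCStarAlgebra.denseRange_of

theorem norm_toCStar (a : WeylStarAlgebra E h) : ‖toCStar E h a‖ = ‖a‖ := WeylCStarAlgebra.norm_of a

end WeylStarAlgebra

/-! ### Positivity on the completion and the extended map. -/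

namespace WeylCStarAlgebra

variable {H : Type*} [NormedAddCommGroup H] [InnerProductSpace ℂ H]
variable {E : Submodule ℝ H} {h : ℝ}

/-- A continuous linear map is positive if it is positive on the squares `d^* d`, `d ∈ Δ(E, 0)`. -/
theorem map_nonneg_of_star_mul_self {B : Type*} [CStarAlgebra B] [PartialOrder B]
    [StarOrderedRing B] (Q : WeylCStarAlgebra E h →L[ℂ] B)
    (hQ : ∀ d : WeylStarAlgebra E h, 0 ≤ Q (WeylStarAlgebra.toCStar E h (star d * d)))
    {a : WeylCStarAlgebra E h} (ha : 0 ≤ a) : 0 ≤ Q a := by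
  obtain ⟨b, rfl⟩ := CStarAlgebra.nonneg_iff_eq_star_mul_self.1 ha
  -- The condition 0 ≤ Q(b^* b) is closed in b, so it suffices to check it for b in the dense
  -- subalgebra.
  refine WeylStarAlgebra.denseRange_toCStar.induction_on b
    (isClosed_le continuous_const (Q.continuous.comp (continuous_star.mul continuous_id)))
    fun d => ?_
  rw [← map_star, ← map_mul]
  exact hQ d

end WeylCStarAlgebra

theorem mainTheorem1 {H : Type*} [NormedAddCommGroup H] [InnerProductSpace ℂ H]
    (E : Submodule ℝ H) (h : ℝ) (hh : 0 ≤ h) :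
    (∀ c : WeylStarAlgebra E 0, ‖weylQuantization E h c‖ ≤ ‖c‖) ∧
    (∀ c : WeylStarAlgebra E 0, 0 ≤ WeylStarAlgebra.toCStar E 0 c →
      0 ≤ WeylStarAlgebra.toCStar E h (weylQuantization E h c)) ∧
    ∃ Q : WeylCStarAlgebra E 0 →L[ℂ] WeylCStarAlgebra E h,
      (∀ c : WeylStarAlgebra E 0,
        Q (WeylStarAlgebra.toCStar E 0 c) =
          WeylStarAlgebra.toCStar E h (weylQuantization E h c)) ∧
      (∀ a : WeylCStarAlgebra E 0, ‖Q a‖ ≤ ‖a‖) ∧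
      (∀ a : WeylCStarAlgebra E 0, 0 ≤ a → 0 ≤ Q a) ∧
      (∀ R : WeylCStarAlgebra E 0 →L[ℂ] WeylCStarAlgebra E h,
        (∀ c : WeylStarAlgebra E 0,
          R (WeylStarAlgebra.toCStar E 0 c) =
            WeylStarAlgebra.toCStar E h (weylQuantization E h c)) → R = Q) := by
  let e : WeylStarAlgebra E 0 →ₗ[ℂ] WeylCStarAlgebra E 0 :=
    (WeylStarAlgebra.toCStar E 0).toAlgHom.toLinearMap
  let q : WeylStarAlgebra E 0 →ₗ[ℂ] WeylCStarAlgebra E h :=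
    (WeylStarAlgebra.toCStar E h).toAlgHom.toLinearMap ∘ₗ weylQuantization E h
  have he : DenseRange e := WeylStarAlgebra.denseRange_toCStar
  have hq (c : WeylStarAlgebra E 0) : ‖q c‖ ≤ 1 * ‖e c‖ := by
    change ‖WeylStarAlgebra.toCStar E h (weylQuantization E h c)‖ ≤
      1 * ‖WeylStarAlgebra.toCStar E 0 c‖
    rw [one_mul, WeylStarAlgebra.norm_toCStar, WeylStarAlgebra.norm_toCStar]
    exact WeylStarAlgebra.norm_weylQuantization_le hh c
  have hQ (c : WeylStarAlgebra E 0) : q.extendOfNorm e (WeylStarAlgebra.toCStar E 0 c) =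
      WeylStarAlgebra.toCStar E h (weylQuantization E h c) :=
    LinearMap.extendOfNorm_eq he ⟨1, hq⟩ c
  have hpos (a : WeylCStarAlgebra E 0) (ha : 0 ≤ a) : 0 ≤ q.extendOfNorm e a :=
    WeylCStarAlgebra.map_nonneg_of_star_mul_self _ (fun d => by
      rw [hQ]
      exact WeylStarAlgebra.toCStar_weylQuantization_star_mul_self_nonneg hh d) ha
  -- Claim (ii) is read off from the extension: a positive c in Δ(E, 0) is b^* b with b in the
  -- completion, and b need not lie in Δ(E, 0).
  refine ⟨WeylStarAlgebra.norm_weylQuantization_le hh, fun c hc => hQ c ▸ hpos _ hc,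
    q.extendOfNorm e, hQ, fun a => ?_, hpos, fun R hR => ?_⟩
  · simpa using LinearMap.norm_extendOfNorm_apply_le he 1 hq a
  · exact (LinearMap.extendOfNorm_unique he 1 hq R (LinearMap.ext hR)).symm
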